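/- Let $F$ be a field of characteristic different from $2$. Let $F_q$ be its quadratic closure, i.e. the smallest subextension of an algebraic closure of $F$ in which every element is a square, and let $G_F=\operatorname{Gal}(F_q/F)$ with its Krull topology. Let $G_F^4[G_F^2,G_F]$ denote the closure of the subgroup of $G_F$ generated by all fourth powers and all commutators of squares with arbitrary elements, and let $\mathcal G_F=G_F/G_F^4[G_F^2,G_F]$ be the W-group of $F$. Assume that $|\mathcal G_F|>2$ ($\mathcal G_F$ may be infinite). Then $F$ is not formally real (that is, $-1$ is a sum of squares in $F$) if and only if every element of order $2$ in $\mathcal G_F$ is central. Moreover, if $F$ is formally real, there are an element $a\in F$, a fourth root $\sqrt[4]{a}\in F_q$ of $a$ and a square root $\sqrt{-1}\in F_q$ of $-1$ such that $L=F(\sqrt[4]{a},\sqrt{-1})$ is a Galois extension of $F$ whose Galois group is isomorphic to the dihedral group $D_4$ of order $8$, such that the restriction of automorphisms from $F_q$ to $L$ induces a surjective homomorphism $\mathcal G_F\to\operatorname{Gal}(L/F)$, and such that some element $\sigma\in\mathcal G_F$ of order $2$ has non-central image in $\operatorname{Gal}(L/F)$; in particular $\sigma$ is not central in $\mathcal G_F$.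 -/

import Mathlib

/-- The quadratic closure `F_q` of a field `F`: the smallest subextension of an algebraic closure
of `F` in which every element is a square. -/
noncomputable def quadraticClosure (F : Type*) [Field F] :
    IntermediateField F (AlgebraicClosure F) :=
  sInf {K | ∀ x ∈ K, ∃ y ∈ K, y ^ 2 = x}

/-- The group `G_F` of automorphisms of the quadratic closure over `F`; it carries
Mathlib's Krull topology. -/
abbrev QuadraticGaloisGroup (F : Type*) [Field F] : Type _ :=
  Gal(quadraticClosure F/F)

/-- The fourth powers and the commutators of squares with arbitrary elements. -/
def wRelators (G : Type*) [Group G] : Set G :=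
  {x | ∃ g : G, x = g ^ 4} ∪ {x | ∃ g h : G, x = g ^ 2 * h * (g ^ 2)⁻¹ * h⁻¹}

instance closure_wRelators_normal (G : Type*) [Group G] :
    (Subgroup.closure (wRelators G)).Normal := by
  have h : ∀ c : G, ∀ x ∈ wRelators G, c * x * c⁻¹ ∈ wRelators G := by
    rintro c x (⟨g, rfl⟩ | ⟨g, k, rfl⟩)
    · exact Or.inl ⟨c * g * c⁻¹, by rw [conj_pow]⟩
    · refine Or.inr ⟨c * g * c⁻¹, c * k * c⁻¹, ?_⟩
      rw [conj_pow]
      group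
  refine ⟨fun n hn c => ?_⟩
  induction hn using Subgroup.closure_induction with
  | mem x hx => exact Subgroup.subset_closure (h c x hx)
  | one => simp [one_mem]
  | mul x y _ _ hx hy =>
    have e : c * (x * y) * c⁻¹ = c * x * c⁻¹ * (c * y * c⁻¹) := by group
    rw [e]
    exact mul_mem hx hy
  | inv x _ hx =>
    have e : c * x⁻¹ * c⁻¹ = (c * x * c⁻¹)⁻¹ := by group
    rw [e]
    exact inv_mem hx

/-- The closed normal subgroup `G_F⁴[G_F², G_F]` of `G_F`: the topological closure of the subgroup
generated by fourth powers and commutators of squares with arbitrary elements. -/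
noncomputable def wKernel (F : Type*) [Field F] : Subgroup (QuadraticGaloisGroup F) :=
  (Subgroup.closure (wRelators (QuadraticGaloisGroup F))).topologicalClosure

instance wKernel_normal (F : Type*) [Field F] : (wKernel F).Normal :=
  Subgroup.is_normal_topologicalClosure _

/-- The W-group `𝒢_F = G_F / G_F⁴[G_F², G_F]` of the field `F`. -/
abbrev WGroup (F : Type*) [Field F] : Type _ :=
  QuadraticGaloisGroup F ⧸ wKernel F

/-! Let `g` represent an element `σ` of the W-group with `σ² = 1`, and let `P` be the set of `a ∈ F`
whose square roots `g` fixes. If `g` fixes all square roots of elements of `F`, Galois theory puts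
it in the closed subgroup generated by squares, which is central modulo the kernel
(`mk_mem_center_of_apply_sqrt_eq`). Otherwise, `g` cannot move both `√u` and `√v` when `u + v = 1`
and `v ≠ 0`, since `g²` would then negate `√(1 + √u)`, an element that the kernel fixes
(`not_apply_eq_neg_of_add_eq_one`). This makes the nonzero part of `P` the positive cone of an
ordering, so `-1` is not a sum of squares.

Conversely, let `F` be formally real. A maximal formally real `K` inside `F_q` is Euclidean, so `F_q
= K(√-1)` and conjugation over `K` is an involution moving `√-1` (`exists_involution`). More than
two elements in the W-group force some `a` with neither `a` nor `-a` a square. Then `F(⁴√a, √-1)`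
has group `D_4`, in which the relators die, and the involution restricts to a reflection, which is
not central. -/

theorem two_ne_zero_of_algebra {F E : Type*} [Field F] [Field E] [Algebra F E]
    (h : (2 : F) ≠ 0) : (2 : E) ≠ 0 := by
  have h' := (map_ne_zero (algebraMap F E)).2 h
  rwa [map_ofNat] at h'

/-! ### The quadratic closure and its Galois group -/

section QuadraticClosure

variable {F : Type*} [Field F]

theorem mem_quadraticClosure {x : AlgebraicClosure F} : x ∈ quadraticClosure F ↔
    ∀ K : IntermediateField F (AlgebraicClosure F), (∀ x ∈ K, ∃ y ∈ K, y ^ 2 = x) → x ∈ K :=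
  IntermediateField.mem_sInf

/-- Square roots are unique up to sign, so a root in the algebraic closure lies in every field of
the intersection. -/
theorem exists_sq_eq (x : quadraticClosure F) : ∃ y : quadraticClosure F, y ^ 2 = x := by
  obtain ⟨y, hy⟩ := IsAlgClosed.exists_pow_nat_eq (x : AlgebraicClosure F) (n := 2) (by norm_num)
  have hmem : y ∈ quadraticClosure F := by
    have hx : (x : AlgebraicClosure F) ∈ quadraticClosure F := x.2
    rw [mem_quadraticClosure] at hx ⊢
    intro K hK
    obtain ⟨z, hz, hzx⟩ := hK x (hx K hK)
    rcases sq_eq_sq_iff_eq_or_eq_neg.1 (hy.trans hzx.symm) with h | h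
    · exact h ▸ hz
    · exact h ▸ neg_mem hz
  exact ⟨⟨y, hmem⟩, Subtype.ext hy⟩

theorem eq_top_of_forall_exists_sq {M : IntermediateField F (quadraticClosure F)}
    (h : ∀ x ∈ M, ∃ y ∈ M, y ^ 2 = x) : M = ⊤ := by
  have hle : quadraticClosure F ≤ IntermediateField.lift M := by
    refine sInf_le fun x hx => ?_
    obtain ⟨x', hx', rfl⟩ := hx
    obtain ⟨y, hy, hyx⟩ := h x' hx'
    exact ⟨y, ⟨y, hy, rfl⟩, by rw [← hyx]; rfl⟩
  refine eq_top_iff.2 fun x _ => ?_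
  have := hle x.2
  exact (IntermediateField.mem_lift x).1 this

instance quadraticClosure_normal : Normal F (quadraticClosure F) := by
  rw [IntermediateField.normal_iff_forall_map_le']
  intro σ
  have key : ∀ K ∈ {K : IntermediateField F (AlgebraicClosure F) |
      ∀ x ∈ K, ∃ y ∈ K, y ^ 2 = x}, quadraticClosure F ≤ K.comap (σ : _ →ₐ[F] _) := by
    intro K hK
    refine sInf_le fun x hx => ?_
    obtain ⟨z, hz, hzx⟩ := hK (σ x) hx
    refine ⟨σ.symm z, ?_, ?_⟩
    · change σ (σ.symm z) ∈ K
      rwa [AlgEquiv.apply_symm_apply]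
    · rw [← map_pow, hzx, AlgEquiv.symm_apply_apply]
  rw [IntermediateField.map_le_iff_le_comap]
  intro x hx
  exact mem_quadraticClosure.2 fun K hK => key K hK hx

/-- Away from characteristic two `X² - x` is separable for `x ≠ 0`, so the separable closure has all
its square roots and contains `F_q`. -/
theorem quadraticClosure_isGalois (h2 : (2 : F) ≠ 0) : IsGalois F (quadraticClosure F) := by
  have hle : quadraticClosure F ≤ separableClosure F (AlgebraicClosure F) := by
    refine sInf_le fun x hx => ?_
    obtain ⟨y, hy⟩ := IsAlgClosed.exists_pow_nat_eq x (n := 2) (by norm_num)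
    refine ⟨y, ?_, hy⟩
    by_cases hx0 : x = 0
    · rw [hx0] at hy
      rw [pow_eq_zero_iff (by norm_num)] at hy
      exact hy ▸ zero_mem _
    let S := separableClosure F (AlgebraicClosure F)
    have h2S : ((2 : ℕ) : S) ≠ 0 := two_ne_zero_of_algebra h2
    have hx' : (⟨x, hx⟩ : S) ≠ 0 := fun h => hx0 (congrArg Subtype.val h)
    have hsep : IsSeparable S y := by
      refine (Polynomial.separable_X_pow_sub_C (⟨x, hx⟩ : S) h2S hx').of_dvd (minpoly.dvd _ _ ?_)
      simp [hy]
    have hmem : y ∈ separableClosure S (AlgebraicClosure F) := hsep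
    rw [separableClosure.separableClosure_eq_bot, IntermediateField.mem_bot] at hmem
    obtain ⟨s, rfl⟩ := hmem
    exact s.2
  have : Algebra.IsSeparable F (quadraticClosure F) := (le_separableClosure_iff _ _ _).1 hle
  exact {}

theorem exists_apply_ne (h2 : (2 : F) ≠ 0) {a : F} (ha : ¬ IsSquare a) {α : quadraticClosure F}
    (hα : α ^ 2 = algebraMap F _ a) : ∃ g : QuadraticGaloisGroup F, g α = -α := by
  have := quadraticClosure_isGalois h2
  by_contra! hne
  have hfix : ∀ g : QuadraticGaloisGroup F, g α = α := fun g => by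
    have : (g α) ^ 2 = α ^ 2 := by rw [← map_pow, hα, AlgEquiv.commutes]
    exact (sq_eq_sq_iff_eq_or_eq_neg.1 this).resolve_right (hne g)
  obtain ⟨b, rfl⟩ := (InfiniteGalois.mem_range_algebraMap_iff_fixed α).2 hfix
  exact ha ⟨b, by rw [← sq]; exact (algebraMap F (quadraticClosure F)).injective (by simp [hα])⟩

theorem apply_eq_or_eq_neg (g : QuadraticGaloisGroup F) {x y : quadraticClosure F}
    (hxy : x ^ 2 = y) (hg : g y = y) : g x = x ∨ g x = -x :=
  sq_eq_sq_iff_eq_or_eq_neg.1 (by rw [← map_pow, hxy, hg])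

theorem isClosed_stabilizer (x : quadraticClosure F) :
    IsClosed (MulAction.stabilizer (QuadraticGaloisGroup F) x : Set (QuadraticGaloisGroup F)) :=
  Subgroup.isClosed_of_isOpen _ (stabilizer_isOpen_of_isIntegral (K := F) (L := quadraticClosure F) x)

/-- Stabilizers are closed in the Krull topology, so fixing a point need only be checked on the
relators. -/
theorem apply_eq_of_mem_wKernel {x : quadraticClosure F}
    (hx : ∀ w ∈ wRelators (QuadraticGaloisGroup F), w x = x) {w : QuadraticGaloisGroup F}
    (hw : w ∈ wKernel F) : w x = x :=
  Subgroup.topologicalClosure_minimal (t := MulAction.stabilizer (QuadraticGaloisGroup F) x) _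
    ((Subgroup.closure_le _).2 hx) (isClosed_stabilizer x) hw

end QuadraticClosure

/-! ### Centrality modulo a closed normal subgroup -/

section QuotientCenter

variable {G : Type*} [Group G] {W : Subgroup G} [W.Normal]

theorem mem_comap_mk_center {k : G} :
    k ∈ (Subgroup.center (G ⧸ W)).comap (QuotientGroup.mk' W) ↔
      ∀ h, k * h * k⁻¹ * h⁻¹ ∈ W := by
  have key : ∀ h, k * h * k⁻¹ * h⁻¹ ∈ W ↔ (h * k : G ⧸ W) = k * h := by
    intro h
    rw [← QuotientGroup.eq_one_iff, QuotientGroup.mk_mul, QuotientGroup.mk_mul,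
      QuotientGroup.mk_mul, QuotientGroup.mk_inv, QuotientGroup.mk_inv, mul_inv_eq_one,
      mul_inv_eq_iff_eq_mul, eq_comm]
  rw [Subgroup.mem_comap, Subgroup.mem_center_iff]
  exact ⟨fun hk h => (key h).2 (hk h),
    fun hk h => QuotientGroup.induction_on h fun h => (key h).1 (hk h)⟩

theorem isClosed_comap_mk_center [TopologicalSpace G] [IsTopologicalGroup G]
    (hW : IsClosed (W : Set G)) :
    IsClosed ((Subgroup.center (G ⧸ W)).comap (QuotientGroup.mk' W) : Set G) := by
  have : ((Subgroup.center (G ⧸ W)).comap (QuotientGroup.mk' W) : Set G) =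
      ⋂ h, (fun k => k * h * k⁻¹ * h⁻¹) ⁻¹' (W : Set G) := by
    ext k
    simp only [Set.mem_iInter, Set.mem_preimage, SetLike.mem_coe]
    exact mem_comap_mk_center
  rw [this]
  exact isClosed_iInter fun h => hW.preimage (by fun_prop)

end QuotientCenter

/-! ### Involutions of the W-group when `-1` is a sum of squares -/

section CentralElements

variable {F : Type*} [Field F]

theorem wRelators_apply {x : quadraticClosure F}
    (h4 : ∀ k : QuadraticGaloisGroup F, (k ^ 4) x = x)
    (hc : ∀ k h : QuadraticGaloisGroup F, (k ^ 2) (h x) = h ((k ^ 2) x)) :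
    ∀ w ∈ wRelators (QuadraticGaloisGroup F), w x = x := by
  rintro w (⟨k, rfl⟩ | ⟨k, h, rfl⟩)
  · exact h4 k
  · have e := hc k⁻¹ h⁻¹
    rw [inv_pow] at e
    rw [AlgEquiv.mul_apply, AlgEquiv.mul_apply, AlgEquiv.mul_apply, e,
      ← AlgEquiv.mul_apply h, mul_inv_cancel, AlgEquiv.one_apply, ← AlgEquiv.mul_apply,
      mul_inv_cancel, AlgEquiv.one_apply]

/-- An automorphism of order at most two modulo the kernel cannot move both `√u` and `√v` when
`u + v = 1`: it would act with order four on a dihedral or cyclic extension of degree dividing 8. -/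
theorem not_apply_eq_neg_of_add_eq_one (h2 : (2 : F) ≠ 0) {g : QuadraticGaloisGroup F}
    (hg : g ^ 2 ∈ wKernel F) {u v : F} (huv : u + v = 1) (hv : v ≠ 0)
    {α β : quadraticClosure F} (hα : α ^ 2 = algebraMap F _ u) (hβ : β ^ 2 = algebraMap F _ v)
    (hgα : g α = -α) (hgβ : g β = -β) : False := by
  have h2E : (2 : quadraticClosure F) ≠ 0 := two_ne_zero_of_algebra h2
  -- Since `(1 + α)(1 - α) = β²`, the conjugates of `δ` are `±δ` and `±β/δ`.
  obtain ⟨δ, hδ⟩ := exists_sq_eq (1 + α)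
  have hαβ : α ^ 2 + β ^ 2 = 1 := by rw [hα, hβ, ← map_add, huv, map_one]
  have hβ0 : β ≠ 0 := by
    rintro rfl
    apply hv
    simpa using hβ.symm
  have hδ0 : δ ≠ 0 := by
    rintro rfl
    have : α = -1 := by linear_combination -hδ
    rw [this] at hαβ
    exact pow_ne_zero 2 hβ0 (by linear_combination hαβ)
  have hfixα : ∀ k : QuadraticGaloisGroup F, k α = α ∨ k α = -α := fun k =>
    apply_eq_or_eq_neg k hα (AlgEquiv.commutes _ _)
  have hfixβ : ∀ k : QuadraticGaloisGroup F, k β = β ∨ k β = -β := fun k =>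
    apply_eq_or_eq_neg k hβ (AlgEquiv.commutes _ _)
  have hconj : ∀ k : QuadraticGaloisGroup F,
      (k δ = δ ∨ k δ = -δ) ∨ (k δ = β / δ ∨ k δ = -(β / δ)) := by
    intro k
    rcases hfixα k with h | h
    · exact Or.inl (apply_eq_or_eq_neg k hδ (by rw [map_add, map_one, h]))
    · refine Or.inr (sq_eq_sq_iff_eq_or_eq_neg.1 ?_)
      rw [← map_pow, hδ, map_add, map_one, h, div_pow, hδ, eq_div_iff (hδ ▸ pow_ne_zero 2 hδ0)]
      linear_combination -hαβ
  have hsq : ∀ k : QuadraticGaloisGroup F, ∀ x, (k x = x ∨ k x = -x) → (k ^ 2) x = x := by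
    intro k x hx
    rw [sq, AlgEquiv.mul_apply]
    rcases hx with h | h <;> simp [h]
  have hsqδ : ∀ k : QuadraticGaloisGroup F, (k ^ 2) δ = δ ∨ (k ^ 2) δ = -δ := fun k =>
    apply_eq_or_eq_neg _ hδ (by rw [map_add, map_one, hsq k α (hfixα k)])
  -- A square `k²` fixes `β` and sends `δ` to `±δ`, so it scales all conjugates of `δ` by the same
  -- sign.
  have hrel : ∀ w ∈ wRelators (QuadraticGaloisGroup F), w δ = δ := by
    refine wRelators_apply (fun k => ?_) fun k h => ?_
    · rw [show 4 = 2 * 2 from rfl, pow_mul]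
      exact hsq _ _ (hsqδ k)
    · have hb := hsq k β (hfixβ k)
      rcases hsqδ k with hk | hk <;> rcases hconj h with (hh | hh) | (hh | hh) <;>
        simp only [hk, hh, hb, map_neg, map_div₀, div_neg]
  have hg2 : g (g δ) = δ := apply_eq_of_mem_wKernel hrel hg
  have hmoved : (g δ) ^ 2 = (β / δ) ^ 2 := by
    rw [← map_pow, hδ, map_add, map_one, hgα, div_pow, hδ, eq_div_iff (hδ ▸ pow_ne_zero 2 hδ0)]
    linear_combination -hαβ
  have hneg : g (g δ) = -δ := by
    rcases sq_eq_sq_iff_eq_or_eq_neg.1 hmoved with h | h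
    · rw [h, map_div₀, hgβ, h]
      field_simp
    · rw [h, map_neg, map_div₀, hgβ, h]
      field_simp
  have : (2 : quadraticClosure F) * δ = 0 := by linear_combination hneg - hg2
  exact (mul_ne_zero h2E hδ0) this

/-- An automorphism fixing the square roots of all elements of `F` fixes every element on which
all squares of automorphisms act trivially. -/
theorem apply_eq_of_forall_sq_apply_eq (h2 : (2 : F) ≠ 0) {g : QuadraticGaloisGroup F}
    (hg : ∀ (a : F) (α : quadraticClosure F), α ^ 2 = algebraMap F _ a → g α = α)
    {x : quadraticClosure F} (hx : ∀ k : QuadraticGaloisGroup F, (k ^ 2) x = x) : g x = x := by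
  have hgal := quadraticClosure_isGalois h2
  have h2E : (2 : quadraticClosure F) ≠ 0 := two_ne_zero_of_algebra h2
  have hfd : FiniteDimensional F (IntermediateField.adjoin F {x}) :=
    IntermediateField.adjoin.finiteDimensional (Algebra.IsIntegral.isIntegral x)
  let L := IntermediateField.normalClosure F (IntermediateField.adjoin F {x}) (quadraticClosure F)
  have hxL : x ∈ L := IntermediateField.le_normalClosure _ (IntermediateField.mem_adjoin_simple_self F x)
  -- Commutators are products of squares, so automorphisms commute on such `v`.
  have hcomm : ∀ v : quadraticClosure F, (∀ k : QuadraticGaloisGroup F, (k ^ 2) v = v) →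
      ∀ s t : QuadraticGaloisGroup F, s (t v) = t (s v) := by
    intro v hv s t
    have e : s * t = t * s * ((s⁻¹) ^ 2 * (s * t⁻¹) ^ 2 * t ^ 2) := by
      simp only [sq]; group
    rw [← AlgEquiv.mul_apply, e, AlgEquiv.mul_apply, AlgEquiv.mul_apply, AlgEquiv.mul_apply,
      AlgEquiv.mul_apply, hv, hv, hv]
  have hmap : ∀ (k : QuadraticGaloisGroup F) {v}, v ∈ L → k v ∈ L := by
    intro k v hv
    have := AlgEquiv.restrictNormal_commutes k L ⟨v, hv⟩
    exact this ▸ (AlgEquiv.restrictNormal k L ⟨v, hv⟩).2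
  -- Simultaneous diagonalization of commuting involutions: `v` is half the sum of the
  -- `t`-eigenvectors `v + t v` and `v - t v`, so `g` need only be tested on common eigenvectors.
  have hsplit : ∀ T : Finset (QuadraticGaloisGroup F),
      (∀ v ∈ L, (∀ k : QuadraticGaloisGroup F, (k ^ 2) v = v) →
        (∀ t ∈ T, t v = v ∨ t v = -v) → g v = v) →
      ∀ y ∈ L, (∀ k : QuadraticGaloisGroup F, (k ^ 2) y = y) → g y = y := by
    classical
    intro T
    induction T using Finset.induction_on with
    | empty => exact fun h y hy hk => h y hy hk (by simp)
    | insert t T _ ih =>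
      intro h
      refine ih fun v hvL hv hT => ?_
      have htv : ∀ k : QuadraticGaloisGroup F, (k ^ 2) (t v) = t v := fun k => by
        rw [hcomm v hv, hv]
      have htt : t (t v) = v := by
        have := hv t
        rwa [sq, AlgEquiv.mul_apply] at this
      have h1 : g (v + t v) = v + t v := by
        refine h _ (add_mem hvL (hmap t hvL)) (fun k => by rw [map_add, hv, htv]) fun s hs => ?_
        rcases Finset.mem_insert.1 hs with rfl | hs
        · left; rw [map_add, htt, add_comm]
        · rcases hT s hs with e | e
          · left; rw [map_add, hcomm v hv, e]
          · right; rw [map_add, hcomm v hv, e, map_neg]; ring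
      have h3 : g (v - t v) = v - t v := by
        refine h _ (sub_mem hvL (hmap t hvL)) (fun k => by rw [map_sub, hv, htv]) fun s hs => ?_
        rcases Finset.mem_insert.1 hs with rfl | hs
        · right; rw [map_sub, htt]; ring
        · rcases hT s hs with e | e
          · left; rw [map_sub, hcomm v hv, e]
          · right; rw [map_sub, hcomm v hv, e, map_neg]; ring
      rw [map_add] at h1
      rw [map_sub] at h3
      exact mul_left_cancel₀ h2E (by linear_combination h1 + h3)
  have hsurj := AlgEquiv.restrictNormalHom_surjective (F := F) (K₁ := L) (quadraticClosure F)
  have : Finite (L ≃ₐ[F] L) := inferInstance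
  have hfin := Set.finite_range (Function.surjInv hsurj)
  refine hsplit hfin.toFinset (fun v hvL hv hT => ?_) x hxL hx
  -- The finite set holds one lift of each element of `Gal(L/F)`, so `v` is an eigenvector of every
  -- automorphism and `v² ∈ F`.
  have hall : ∀ k : QuadraticGaloisGroup F, k v = v ∨ k v = -v := by
    intro k
    set t := Function.surjInv hsurj (AlgEquiv.restrictNormalHom L k) with ht
    have hres : AlgEquiv.restrictNormalHom L t = AlgEquiv.restrictNormalHom L k :=
      Function.surjInv_eq hsurj _
    have hkt : k v = t v := by
      have e1 := AlgEquiv.restrictNormal_commutes k L ⟨v, hvL⟩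
      have e2 := AlgEquiv.restrictNormal_commutes t L ⟨v, hvL⟩
      exact e1.symm.trans ((congrArg (fun φ : L ≃ₐ[F] L =>
        algebraMap L (quadraticClosure F) (φ ⟨v, hvL⟩)) hres.symm).trans e2)
    rw [hkt]
    exact hT t (by simp [ht])
  obtain ⟨a, ha⟩ := (InfiniteGalois.mem_range_algebraMap_iff_fixed (v ^ 2)).2 fun k => by
    rw [map_pow]
    rcases hall k with h | h <;> simp [h]
  exact hg a v ha.symm

theorem isClosed_wKernel (F : Type*) [Field F] :
    IsClosed (wKernel F : Set (QuadraticGaloisGroup F)) :=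
  Subgroup.isClosed_topologicalClosure (Subgroup.closure (wRelators (QuadraticGaloisGroup F)))

/-- By the Galois correspondence `g` lies in the closure of the subgroup generated by squares.
Squares are central modulo the kernel, and the preimage of the center is closed. -/
theorem mk_mem_center_of_apply_sqrt_eq (h2 : (2 : F) ≠ 0) {g : QuadraticGaloisGroup F}
    (hg : ∀ (a : F) (α : quadraticClosure F), α ^ 2 = algebraMap F _ a → g α = α) :
    (QuotientGroup.mk g : WGroup F) ∈ Subgroup.center (WGroup F) := by
  have hgal := quadraticClosure_isGalois h2
  let S : Subgroup (QuadraticGaloisGroup F) := Subgroup.closure {s | ∃ k, s = k ^ 2}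
  let N : ClosedSubgroup (QuadraticGaloisGroup F) :=
    ⟨S.topologicalClosure, S.isClosed_topologicalClosure⟩
  have hgN : g ∈ S.topologicalClosure := by
    have hfix := InfiniteGalois.fixingSubgroup_fixedField N
    change g ∈ N.toSubgroup
    rw [← hfix, IntermediateField.mem_fixingSubgroup_iff]
    intro x hx
    refine apply_eq_of_forall_sq_apply_eq h2 hg fun k => ?_
    exact hx ⟨k ^ 2, S.le_topologicalClosure (Subgroup.subset_closure ⟨k, rfl⟩)⟩
  have hle : S.topologicalClosure ≤
      (Subgroup.center (WGroup F)).comap (QuotientGroup.mk' (wKernel F)) := by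
    refine Subgroup.topologicalClosure_minimal _ ((Subgroup.closure_le _).2 ?_)
      (isClosed_comap_mk_center (isClosed_wKernel F))
    rintro _ ⟨k, rfl⟩
    exact mem_comap_mk_center.2 fun h =>
      Subgroup.le_topologicalClosure _ (Subgroup.subset_closure (Or.inr ⟨k, h, rfl⟩))
  exact hle hgN

/-- If `-1` is a sum of squares, then every element of order dividing two of the W-group is
central. -/
theorem mem_center_of_sq_eq_one (h2 : (2 : F) ≠ 0) (hF : IsSumSq (-1 : F)) {σ : WGroup F}
    (hσ : σ ^ 2 = 1) : σ ∈ Subgroup.center (WGroup F) := by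
  obtain ⟨g, rfl⟩ := QuotientGroup.mk_surjective σ
  have hgk : g ^ 2 ∈ wKernel F := (QuotientGroup.eq_one_iff _).1 hσ
  by_contra hnc
  have hex : ∃ (a : F) (α : quadraticClosure F), α ^ 2 = algebraMap F _ a ∧ g α ≠ α := by
    by_contra! h
    exact hnc (mk_mem_center_of_apply_sqrt_eq h2 h)
  choose r hr using fun a : F => exists_sq_eq (algebraMap F (quadraticClosure F) a)
  let P : F → Prop := fun a => g (r a) = r a
  have hdich : ∀ a, P a ∨ g (r a) = -r a := fun a =>
    apply_eq_or_eq_neg g (hr a) (AlgEquiv.commutes _ _)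
  have h2E : (2 : quadraticClosure F) ≠ 0 := two_ne_zero_of_algebra h2
  have hP : ∀ {a α}, α ^ 2 = algebraMap F (quadraticClosure F) a → (P a ↔ g α = α) := by
    intro a α h
    rcases sq_eq_sq_iff_eq_or_eq_neg.1 ((hr a).trans h.symm) with e | e
    · simp only [P, e]
    · simp only [P, e, map_neg, neg_inj]
  have hr0 : ∀ {a}, a ≠ 0 → r a ≠ 0 := by
    intro a ha h
    have := hr a
    rw [h] at this
    exact ha (by simpa using this.symm)
  have hself : ∀ {x : quadraticClosure F}, x ≠ 0 → x ≠ -x := fun {x} hx h =>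
    mul_ne_zero h2E hx (by linear_combination h)
  have hneg : ∀ {a}, a ≠ 0 → (¬ P a ↔ g (r a) = -r a) := by
    intro a ha
    refine ⟨(hdich a).resolve_left, fun h h' => hself (hr0 ha) (h'.symm.trans h)⟩
  have hmul : ∀ {a b}, (r a * r b) ^ 2 = algebraMap F (quadraticClosure F) (a * b) := by
    intro a b
    rw [mul_pow, hr, hr, map_mul]
  have hPsq : ∀ a, P (a ^ 2) := fun a => (hP (by rw [map_pow])).2 (AlgEquiv.commutes _ a)
  have hPmul : ∀ {a b}, P a → P b → P (a * b) := fun {a b} ha hb =>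
    (hP hmul).2 (by rw [map_mul, ha, hb])
  have hNmul : ∀ {a b}, a ≠ 0 → b ≠ 0 → ¬ P a → P b → ¬ P (a * b) := fun {a b} ha hb hna hpb h => by
    have h := (hP hmul).1 h
    rw [map_mul, (hneg ha).1 hna, hpb, neg_mul] at h
    exact hself (mul_ne_zero (hr0 ha) (hr0 hb)) h.symm
  have hone : ∀ {u v : F}, u + v = 1 → u ≠ 0 → v ≠ 0 → P u ∨ P v := by
    intro u v huv hu hv
    by_contra! h
    exact not_apply_eq_neg_of_add_eq_one h2 hgk huv hv (hr u) (hr v) ((hneg hu).1 h.1)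
      ((hneg hv).1 h.2)
  obtain ⟨a, α, hα, hgα⟩ := hex
  have hPa : ¬ P a := fun h => hgα ((hP hα).1 h)
  have ha0 : a ≠ 0 := by
    rintro rfl
    apply hgα
    have : α = 0 := by simpa using hα
    rw [this, map_zero]
  have hm1 : ¬ P (-1) := by
    intro h
    have ha1 : a ≠ 1 := by
      rintro rfl
      exact hPa (by simpa using hPsq 1)
    have ha1' : a + 1 ≠ 0 := fun h' => hPa (by rwa [show a = -1 by linear_combination h'])
    have ha1'' : a - 1 ≠ 0 := sub_ne_zero.2 ha1
    -- Chosen so that `a x² - a y² = 1`; if `-1` were in `P`, `g` would move the roots of both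
    -- terms.
    let x : F := (a + 1) / (2 * a)
    let y : F := (a - 1) / (2 * a)
    have hx : x ≠ 0 := div_ne_zero ha1' (mul_ne_zero h2 ha0)
    have hy : y ≠ 0 := div_ne_zero ha1'' (mul_ne_zero h2 ha0)
    have hxy : a * x ^ 2 + a * (-1 * y ^ 2) = 1 := by
      simp only [x, y]
      field_simp
      ring
    have hy' : -1 * y ^ 2 ≠ 0 := mul_ne_zero (neg_ne_zero.2 one_ne_zero) (pow_ne_zero 2 hy)
    rcases hone hxy (mul_ne_zero ha0 (pow_ne_zero 2 hx)) (mul_ne_zero ha0 hy') with h' | h'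
    · exact hNmul ha0 (pow_ne_zero 2 hx) hPa (hPsq x) h'
    · exact hNmul ha0 hy' hPa (hPmul h (hPsq y)) h'
  have hadd : ∀ {b c : F}, b ≠ 0 → c ≠ 0 → P b → P c → b + c ≠ 0 ∧ P (b + c) := by
    intro b c hb hc hPb hPc
    have hd : b + c ≠ 0 := by
      intro h
      have hc' : c = -1 * b := by linear_combination h
      rw [hc'] at hPc
      exact hNmul (neg_ne_zero.2 one_ne_zero) hb hm1 hPb hPc
    refine ⟨hd, ?_⟩
    by_contra hn
    have hinv : ¬ P (b + c)⁻¹ := fun h => by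
      have := hPmul h (hPsq (b + c))
      rw [show (b + c)⁻¹ * (b + c) ^ 2 = b + c by field_simp] at this
      exact hn this
    have hd' := inv_ne_zero hd
    -- Dividing `b + c` by itself writes `1` as a sum of two elements outside `P`.
    rcases hone (u := (b + c)⁻¹ * b) (v := (b + c)⁻¹ * c) (by field_simp)
      (mul_ne_zero hd' hb) (mul_ne_zero hd' hc) with h | h
    · exact hNmul hd' hb hinv hPb h
    · exact hNmul hd' hc hinv hPc h
  have hsum : ∀ s : F, IsSumSq s → s = 0 ∨ P s := by
    intro s hs
    induction hs with
    | zero => exact Or.inl rfl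
    | @sq_add b s _ ih =>
      by_cases hb : b = 0
      · simpa [hb] using ih
      have hPb : P (b * b) := by rw [← sq]; exact hPsq b
      rcases ih with rfl | ih
      · right; rwa [add_zero]
      · by_cases hs0 : s = 0
        · right; rwa [hs0, add_zero]
        · exact Or.inr (hadd (mul_ne_zero hb hb) hs0 hPb ih).2
  rcases hsum _ hF with h | h
  · exact neg_ne_zero.2 one_ne_zero h
  · exact hm1 h

end CentralElements

/-! ### Sums of squares in fields -/

section SumsOfSquares

theorem IsSumSq.map_ringHom {R S : Type*} [Semiring R] [Semiring S] (f : R →+* S) {s : R}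
    (hs : IsSumSq s) : IsSumSq (f s) := by
  induction hs with
  | zero => rw [map_zero]; exact IsSumSq.zero
  | sq_add a _ ih => rw [map_add, map_mul]; exact IsSumSq.sq_add _ ih

theorem IsSumSq.inv {K : Type*} [Field K] {s : K} (hs : IsSumSq s) : IsSumSq s⁻¹ := by
  by_cases h : s = 0
  · rw [h, inv_zero]; exact IsSumSq.zero
  · have : s⁻¹ = s * (s⁻¹ * s⁻¹) := by field_simp
    rw [this]
    exact hs.mul (IsSumSq.mul_self _)

end SumsOfSquares

/-! ### Formal reality in quadratic extensions and chains -/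

section QuadraticExtension

variable {F E : Type*} [Field F] [Field E] [Algebra F E]

/-- The intermediate field `K + Kα` for `α² ∈ K`. -/
def IntermediateField.quadraticExtension (K : IntermediateField F E) (α : E) (hα : α ^ 2 ∈ K) :
    IntermediateField F E where
  carrier := {z | ∃ x ∈ K, ∃ y ∈ K, z = x + α * y}
  mul_mem' := by
    rintro _ _ ⟨x, hx, y, hy, rfl⟩ ⟨x', hx', y', hy', rfl⟩
    exact ⟨x * x' + α ^ 2 * (y * y'), add_mem (mul_mem hx hx') (mul_mem hα (mul_mem hy hy')),
      x * y' + x' * y, add_mem (mul_mem hx hy') (mul_mem hx' hy), by ring⟩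
  add_mem' := by
    rintro _ _ ⟨x, hx, y, hy, rfl⟩ ⟨x', hx', y', hy', rfl⟩
    exact ⟨x + x', add_mem hx hx', y + y', add_mem hy hy', by ring⟩
  algebraMap_mem' r := ⟨algebraMap F E r, K.algebraMap_mem r, 0, zero_mem K, by ring⟩
  inv_mem' := by
    rintro _ ⟨x, hx, y, hy, rfl⟩
    by_cases hαK : α ∈ K
    · exact ⟨(x + α * y)⁻¹, inv_mem (add_mem hx (mul_mem hαK hy)), 0, zero_mem K, by ring⟩
    by_cases hn : x ^ 2 - α ^ 2 * y ^ 2 = 0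
    · have hy0 : y = 0 := by
        by_contra hy0
        have h : α ^ 2 = (x / y) ^ 2 := by
          rw [div_pow, eq_div_iff (pow_ne_zero 2 hy0)]
          linear_combination -hn
        rcases sq_eq_sq_iff_eq_or_eq_neg.1 h with h | h
        · exact hαK (h ▸ div_mem hx hy)
        · exact hαK (h ▸ neg_mem (div_mem hx hy))
      exact ⟨x⁻¹, inv_mem hx, 0, zero_mem K, by simp [hy0]⟩
    · have hnK : x ^ 2 - α ^ 2 * y ^ 2 ∈ K := sub_mem (pow_mem hx 2) (mul_mem hα (pow_mem hy 2))
      have hne : x + α * y ≠ 0 := fun h => hn (by linear_combination (x - α * y) * h)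
      refine ⟨x / (x ^ 2 - α ^ 2 * y ^ 2), div_mem hx hnK, -y / (x ^ 2 - α ^ 2 * y ^ 2),
        div_mem (neg_mem hy) hnK, ?_⟩
      rw [inv_eq_iff_eq_inv, eq_comm, inv_eq_iff_eq_inv, eq_comm]
      rw [inv_eq_of_mul_eq_one_right]
      field_simp
      ring

theorem IntermediateField.mem_quadraticExtension {K : IntermediateField F E} {α : E}
    {hα : α ^ 2 ∈ K} {z : E} :
    z ∈ K.quadraticExtension α hα ↔ ∃ x ∈ K, ∃ y ∈ K, z = x + α * y :=
  Iff.rfl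

theorem IntermediateField.le_quadraticExtension {K : IntermediateField F E} {α : E}
    (hα : α ^ 2 ∈ K) : K ≤ K.quadraticExtension α hα :=
  fun x hx => ⟨x, hx, 0, zero_mem K, by ring⟩

theorem IntermediateField.self_mem_quadraticExtension {K : IntermediateField F E} {α : E}
    (hα : α ^ 2 ∈ K) : α ∈ K.quadraticExtension α hα :=
  ⟨0, zero_mem K, 1, one_mem K, by ring⟩

theorem exists_eq_of_isSumSq_quadraticExtension {K : IntermediateField F E} {α : E}
    {hα : α ^ 2 ∈ K} {t : K.quadraticExtension α hα} (ht : IsSumSq t) :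
    ∃ S T U : K, IsSumSq S ∧ IsSumSq T ∧ (t : E) = S + α ^ 2 * T + α * U := by
  induction ht with
  | zero => exact ⟨0, 0, 0, .zero, .zero, by simp⟩
  | sq_add a _ ih =>
    obtain ⟨S, T, U, hS, hT, h⟩ := ih
    obtain ⟨x, hx, y, hy, hxy⟩ := a.2
    refine ⟨⟨x, hx⟩ * ⟨x, hx⟩ + S, ⟨y, hy⟩ * ⟨y, hy⟩ + T, ⟨x, hx⟩ * ⟨y, hy⟩ + ⟨x, hx⟩ * ⟨y, hy⟩ + U,
      hS.sq_add _, hT.sq_add _, ?_⟩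
    push_cast
    rw [h, hxy]
    ring

/-- Comparing coordinates gives `-1 = S + aT`. Formal reality of `K` forces `T ≠ 0`, so `-a = (1 +
S)/T`. -/
theorem isSumSq_neg_of_isSumSq_neg_one_quadraticExtension {K : IntermediateField F E} {α : E}
    {a : K} (hαa : α ^ 2 = a) (hαK : α ∉ K) (hα : α ^ 2 ∈ K) (hK : ¬ IsSumSq (-1 : K))
    (h : IsSumSq (-1 : K.quadraticExtension α hα)) : IsSumSq (-a) := by
  obtain ⟨S, T, U, hS, hT, h⟩ := exists_eq_of_isSumSq_quadraticExtension h
  rw [hαa] at h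
  have hU : U = 0 := by
    by_contra hU
    have hU' : (U : E) ≠ 0 := fun h' => hU (Subtype.ext h')
    have hα' : α = (((-1 - S - a * T) / U : K) : E) := by
      push_cast at h ⊢
      rw [eq_div_iff hU']
      linear_combination -h
    exact hαK (hα' ▸ SetLike.coe_mem _)
  have hST : (-1 : K) = S + a * T := by
    apply Subtype.ext
    push_cast
    rw [hU] at h
    push_cast at h
    linear_combination h
  have hT0 : T ≠ 0 := by
    rintro rfl
    exact hK (by rwa [hST, mul_zero, add_zero])
  have : -a = (1 + S) * T⁻¹ := by
    rw [eq_mul_inv_iff_mul_eq₀ hT0]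
    linear_combination hST
  rw [this]
  exact (IsSumSq.one.add hS).mul hT.inv

/-- A sum of squares involves finitely many elements, which lie in one member of the chain. This
gives the upper bound for Zorn's lemma. -/
theorem exists_isSumSq_of_mem_sSup_chain {c : Set (IntermediateField F E)}
    (hc : IsChain (· ≤ ·) c) (hne : c.Nonempty) {t : (sSup c : IntermediateField F E)}
    (ht : IsSumSq t) : ∃ K ∈ c, ∃ t' : K, IsSumSq t' ∧ (t' : E) = t := by
  have hmem : ∀ x : E, x ∈ sSup c → ∃ K ∈ c, x ∈ K := by
    intro x hx
    have : Nonempty c := hne.to_subtype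
    rw [sSup_eq_iSup', ← SetLike.mem_coe,
      IntermediateField.coe_iSup_of_directed hc.directed] at hx
    simpa using hx
  induction ht with
  | zero =>
    obtain ⟨K, hK⟩ := hne
    exact ⟨K, hK, 0, .zero, rfl⟩
  | sq_add a _ ih =>
    obtain ⟨K, hK, t', ht', h⟩ := ih
    obtain ⟨K', hK', ha⟩ := hmem a a.2
    rcases hc.total hK hK' with hle | hle
    · refine ⟨K', hK', ⟨a, ha⟩ * ⟨a, ha⟩ + IntermediateField.inclusion hle t',
        (ht'.map_ringHom (IntermediateField.inclusion hle).toRingHom).sq_add _, ?_⟩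
      push_cast
      rw [← h]
      rfl
    · refine ⟨K, hK, ⟨a, hle ha⟩ * ⟨a, hle ha⟩ + t', ht'.sq_add _, ?_⟩
      push_cast
      rw [← h]

theorem exists_maximal_not_isSumSq_neg_one (h : ¬ IsSumSq (-1 : F)) :
    ∃ K : IntermediateField F E,
      Maximal (fun K : IntermediateField F E => ¬ IsSumSq (-1 : K)) K := by
  have hbot : ¬ IsSumSq (-1 : (⊥ : IntermediateField F E)) := by
    intro hs
    have := hs.map_ringHom (IntermediateField.botEquiv F E).toRingEquiv.toRingHom
    rw [map_neg, map_one] at this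
    exact h this
  have hchain : ∀ c ⊆ {K : IntermediateField F E | ¬ IsSumSq (-1 : K)}, IsChain (· ≤ ·) c →
      ∀ K ∈ c, ∃ B ∈ {K : IntermediateField F E | ¬ IsSumSq (-1 : K)}, ∀ z ∈ c, z ≤ B := by
    intro c hcs hc K hK
    refine ⟨sSup c, fun hs => ?_, fun z hz => le_sSup hz⟩
    obtain ⟨K', hK', t, ht, hte⟩ := exists_isSumSq_of_mem_sSup_chain hc ⟨K, hK⟩ hs
    have : t = -1 := Subtype.ext (by rw [hte]; push_cast; rfl)
    exact hcs hK' (this ▸ ht)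
  obtain ⟨K, -, hK⟩ := zorn_le_nonempty₀ _ hchain ⊥ hbot
  exact ⟨K, hK⟩

end QuadraticExtension

/-! ### Euclidean subfields and complex conjugation -/

section Euclidean

variable {F : Type*} [Field F]

/-- If `b` is not a square, maximality makes `-1` a sum of squares in `K(√b)`, hence `-b` one in
`K`. Were this so for both `b = a` and `b = -a`, then `-1 = (-a)a⁻¹` would be a sum of squares. -/
theorem isSquare_or_isSquare_neg_of_maximal {K : IntermediateField F (quadraticClosure F)}
    (hK : Maximal (fun K : IntermediateField F (quadraticClosure F) => ¬ IsSumSq (-1 : K)) K)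
    (a : K) : IsSquare a ∨ IsSquare (-a) := by
  have key : ∀ b : K, ¬ IsSquare b → IsSumSq (-b) := by
    intro b hb
    obtain ⟨β, hβ⟩ := exists_sq_eq (b : quadraticClosure F)
    have hβK : β ∉ K := fun h => hb ⟨⟨β, h⟩, Subtype.ext (by rw [← hβ, sq]; rfl)⟩
    have hβ2 : β ^ 2 ∈ K := hβ ▸ b.2
    refine isSumSq_neg_of_isSumSq_neg_one_quadraticExtension hβ hβK hβ2 hK.prop ?_
    by_contra hn
    exact hβK (hK.le_of_ge hn (IntermediateField.le_quadraticExtension hβ2)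
      (IntermediateField.self_mem_quadraticExtension hβ2))
  by_contra! h
  have h1 := key a h.1
  have h2 := key (-a) h.2
  rw [neg_neg] at h2
  have ha0 : a ≠ 0 := by
    rintro rfl
    exact h.1 ⟨0, by simp⟩
  apply hK.prop
  have : (-1 : K) = -a * a⁻¹ := by rw [neg_mul, mul_inv_cancel₀ ha0]
  rw [this]
  exact h1.mul h2.inv

/-- If `K` is Euclidean inside the quadratic closure, then the quadratic closure is `K(√-1)`. -/
theorem exists_eq_add_mul_of_euclidean (h2 : (2 : F) ≠ 0)
    {K : IntermediateField F (quadraticClosure F)} (hK : ¬ IsSumSq (-1 : K))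
    (hsq : ∀ a : K, IsSquare a ∨ IsSquare (-a)) {i : quadraticClosure F} (hi : i ^ 2 = -1)
    (z : quadraticClosure F) : ∃ x ∈ K, ∃ y ∈ K, z = x + i * y := by
  have h2K : (2 : K) ≠ 0 := two_ne_zero_of_algebra h2
  have hi2 : i ^ 2 ∈ K := hi ▸ neg_mem (one_mem K)
  have hnsq : ∀ {a : K}, a ≠ 0 → IsSumSq a → ¬ IsSumSq (-a) := by
    intro a ha h1 h3
    have : (-1 : K) = -a * a⁻¹ := by rw [neg_mul, mul_inv_cancel₀ ha]
    exact hK (this ▸ h3.mul h1.inv)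
  have hsum : ∀ {a : K}, IsSumSq a → IsSquare a := by
    intro a ha
    refine (hsq a).elim id fun h => ?_
    by_cases ha0 : a = 0
    · exact ⟨0, by simp [ha0]⟩
    · exact (hnsq ha0 ha h.isSumSq).elim
  -- These equations say `(p + iq)² = x + iy`.
  have hroot : ∀ x y : K, ∃ p q : K, p ^ 2 - q ^ 2 = x ∧ 2 * p * q = y := by
    intro x y
    by_cases hy : y = 0
    · rcases hsq x with ⟨p, hp⟩ | ⟨q, hq⟩
      · exact ⟨p, 0, by rw [hp]; ring, by rw [hy]; ring⟩
      · exact ⟨0, q, by linear_combination hq, by rw [hy]; ring⟩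
    obtain ⟨c, hc⟩ := hsum ((IsSumSq.mul_self x).add (IsSumSq.mul_self y))
    have hfin : ∀ d : K, d ^ 2 = x ^ 2 + y ^ 2 → IsSquare ((x + d) / 2) →
        ∃ p q : K, p ^ 2 - q ^ 2 = x ∧ 2 * p * q = y := by
      rintro d hd ⟨p, hp⟩
      rw [div_eq_iff h2K] at hp
      have hp0 : p ≠ 0 := by
        rintro rfl
        have hd' : d = -x := by linear_combination hp
        rw [hd'] at hd
        exact pow_ne_zero 2 hy (by linear_combination -hd)
      refine ⟨p, y / (2 * p), ?_, by field_simp⟩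
      have hd' : d = 2 * p ^ 2 - x := by linear_combination hp
      rw [hd'] at hd
      field_simp
      linear_combination hd
    -- The candidates `(x ± c)/2` for `p²` have product `-(y/2)²`; if both were negatives of
    -- squares, this product would be a square.
    rcases hsq ((x + c) / 2) with h | ⟨s, hs⟩
    · exact hfin c (by linear_combination -hc) h
    rcases hsq ((x - c) / 2) with h | ⟨t, ht⟩
    · exact hfin (-c) (by linear_combination -hc) (by rwa [← sub_eq_add_neg])
    · exfalso
      have hprod : (s * t) * (s * t) = -((y / 2) * (y / 2)) := by
        have : (s * t) * (s * t) = (s * s) * (t * t) := by ring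
        rw [this, ← hs, ← ht]
        field_simp
        linear_combination hc
      have hy2 : (y / 2) * (y / 2) ≠ 0 :=
        mul_ne_zero (div_ne_zero hy h2K) (div_ne_zero hy h2K)
      exact hnsq hy2 (IsSumSq.mul_self _) (hprod ▸ IsSumSq.mul_self _)
  have htop : K.quadraticExtension i hi2 = ⊤ := by
    refine eq_top_of_forall_exists_sq ?_
    rintro _ ⟨x, hx, y, hy, rfl⟩
    obtain ⟨p, q, h1, h3⟩ := hroot ⟨x, hx⟩ ⟨y, hy⟩
    refine ⟨p + i * q, ⟨p, p.2, q, q.2, rfl⟩, ?_⟩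
    have h1' := congrArg Subtype.val h1
    have h3' := congrArg Subtype.val h3
    push_cast at h1' h3'
    have h22 : ((2 : K) : quadraticClosure F) = 2 := rfl
    rw [h22] at h3'
    linear_combination h1' + i * h3' + (q : quadraticClosure F) ^ 2 * hi
  exact htop.symm.le IntermediateField.mem_top

theorem exists_involution (h2 : (2 : F) ≠ 0) (h : ¬ IsSumSq (-1 : F)) {i : quadraticClosure F}
    (hi : i ^ 2 = -1) : ∃ g : QuadraticGaloisGroup F, g ^ 2 = 1 ∧ g i = -i := by
  have := quadraticClosure_isGalois h2
  obtain ⟨K, hK⟩ := exists_maximal_not_isSumSq_neg_one (E := quadraticClosure F) h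
  have hiK : i ∉ K := fun hiK => hK.prop (by
    have : (-1 : K) = ⟨i, hiK⟩ * ⟨i, hiK⟩ := Subtype.ext (by rw [← sq]; simp [hi])
    rw [this]
    exact IsSumSq.mul_self _)
  have hex : ∃ g : Gal(quadraticClosure F/K), g i ≠ i := by
    by_contra! hfix
    obtain ⟨x, hx⟩ := (InfiniteGalois.mem_range_algebraMap_iff_fixed i).2 hfix
    exact hiK (hx ▸ x.2)
  obtain ⟨g, hg⟩ := hex
  have hgi : g i = -i := by
    have : (g i) ^ 2 = i ^ 2 := by rw [← map_pow, hi, map_neg, map_one]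
    exact (sq_eq_sq_iff_eq_or_eq_neg.1 this).resolve_left hg
  refine ⟨g.restrictScalars F, ?_, hgi⟩
  ext1 z
  obtain ⟨x, hx, y, hy, rfl⟩ := exists_eq_add_mul_of_euclidean h2 hK.prop
    (isSquare_or_isSquare_neg_of_maximal hK) hi z
  have hgx : ∀ x ∈ K, g x = x := fun x hx => g.commutes ⟨x, hx⟩
  change g (g (x + i * y)) = x + i * y
  simp only [map_add, map_mul, hgx x hx, hgx y hy, hgi, map_neg, neg_neg]

/-- Otherwise `F` itself is Euclidean and `F_q = F(i)`, so an automorphism is determined by whether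
it fixes `i`. -/
theorem exists_not_isSquare_of_two_lt_card (h2 : (2 : F) ≠ 0) (h : ¬ IsSumSq (-1 : F))
    (hcard : 2 < ENat.card (WGroup F)) : ∃ a : F, ¬ IsSquare a ∧ ¬ IsSquare (-a) := by
  by_contra! hsq
  apply hcard.not_ge
  let e := IntermediateField.botEquiv F (quadraticClosure F)
  obtain ⟨i, hi⟩ := exists_sq_eq (-1 : quadraticClosure F)
  have hz := exists_eq_add_mul_of_euclidean h2 (K := ⊥)
    (fun hs => h (by
      have := hs.map_ringHom e.toRingEquiv.toRingHom
      rwa [map_neg, map_one] at this))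
    (fun a => by
      have hb : ∀ b, IsSquare (e b) → IsSquare b := fun b hb => by
        simpa using hb.map e.symm
      by_cases ha : IsSquare (e a)
      · exact Or.inl (hb a ha)
      · exact Or.inr (hb _ (by rw [map_neg]; exact hsq _ ha))) hi
  have hfix : ∀ (g : QuadraticGaloisGroup F), ∀ x ∈ (⊥ : IntermediateField F (quadraticClosure F)),
      g x = x := by
    rintro g _ ⟨x, rfl⟩
    exact g.commutes x
  have hinj : Function.Injective (fun g : QuadraticGaloisGroup F => (g i = i : Prop)) := by
    intro g g' hgg
    have hgg' : g i = i ↔ g' i = i := iff_of_eq hgg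
    have hi' : g i = g' i := by
      have h1 := apply_eq_or_eq_neg g hi (by rw [map_neg, map_one])
      have h3 := apply_eq_or_eq_neg g' hi (by rw [map_neg, map_one])
      by_cases hgi : g i = i
      · rw [hgi, hgg'.1 hgi]
      · rw [h1.resolve_left hgi, h3.resolve_left fun h => hgi (hgg'.2 h)]
    ext1 z
    obtain ⟨x, hx, y, hy, rfl⟩ := hz z
    rw [map_add, map_add, map_mul, map_mul, hfix g x hx, hfix g' x hx, hfix g y hy, hfix g' y hy,
      hi']
  calc ENat.card (WGroup F) ≤ ENat.card Prop :=
        ENat.card_le_card_of_injective (hinj.comp Quotient.out_injective)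
    _ = 2 := by simp

end Euclidean

/-! ### The dihedral action on a fourth root and `√-1` -/

section Dihedral

open DihedralGroup

theorem DihedralGroup.four_wRelators_eq_one :
    ∀ d ∈ wRelators (DihedralGroup 4), d = 1 := by
  have h4 : ∀ g : DihedralGroup 4, g ^ 4 = 1 := by decide
  have hc : ∀ g h : DihedralGroup 4, g ^ 2 * h * (g ^ 2)⁻¹ * h⁻¹ = 1 := by decide
  rintro _ (⟨g, rfl⟩ | ⟨g, h, rfl⟩)
  · exact h4 g
  · exact hc g h

theorem DihedralGroup.four_eq_pow_mul_pow : ∀ k j : ZMod 4, k ≠ 0 → k ≠ 2 →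
    ∀ d : DihedralGroup 4, ∃ n m : Fin 4, d = r k ^ (n : ℕ) * sr j ^ (m : ℕ) := by
  decide

variable {F L : Type*} [Field F] [Field L] [Algebra F L]

/-- The automorphism `φ` acts on a primitive fourth root of unity `i` and on a fourth root `x` of an
element of the base field as the element `d` of the dihedral group prescribes. -/
def ActsAsDihedral (x i : L) (φ : Gal(L/F)) : DihedralGroup 4 → Prop
  | r k => φ i = i ∧ φ x = i ^ k.val * x
  -- `sr k` is the product `s * r k`, and the reflection `s`, fixing `x` and negating `i`, inverts
  -- `i ^ k`.
  | sr k => φ i = -i ∧ φ x = i ^ (-k).val * x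

section

variable {x i : L}

theorem ne_zero_of_sq_eq_neg_one (hi : i ^ 2 = -1) : i ≠ 0 := by
  rintro rfl
  rw [zero_pow two_ne_zero, eq_comm, neg_eq_zero] at hi
  exact one_ne_zero hi

theorem ne_neg_of_sq_eq_neg_one (h2 : (2 : L) ≠ 0) (hi : i ^ 2 = -1) : i ≠ -i := fun h =>
  mul_ne_zero h2 (ne_zero_of_sq_eq_neg_one hi) (by linear_combination h)

theorem pow_val_add (hi : i ^ 2 = -1) (k l : ZMod 4) :
    i ^ (k + l).val = i ^ k.val * i ^ l.val := by
  have h4 : i ^ 4 = 1 := by linear_combination (i ^ 2 - 1) * hi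
  rw [ZMod.val_add, ← pow_eq_pow_mod _ h4, pow_add]

theorem neg_pow_val (hi : i ^ 2 = -1) (k : ZMod 4) : (-i) ^ k.val = i ^ (-k).val := by
  have hi0 := ne_zero_of_sq_eq_neg_one hi
  apply mul_right_cancel₀ (pow_ne_zero k.val hi0)
  rw [← mul_pow, ← pow_val_add hi, neg_add_cancel, ZMod.val_zero, pow_zero,
    show -i * i = 1 by linear_combination -hi, one_pow]

theorem pow_val_injective (h2 : (2 : L) ≠ 0) (hi : i ^ 2 = -1) :
    Function.Injective fun k : ZMod 4 => i ^ k.val := by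
  have hord : orderOf i = 4 := by
    refine orderOf_eq_prime_pow (p := 2) (n := 1) (fun h => h2 ?_) ?_
    · rw [pow_one, hi] at h
      linear_combination -h
    · linear_combination (i ^ 2 - 1) * hi
  intro k l hkl
  apply ZMod.val_injective 4
  exact pow_injOn_Iio_orderOf (by simpa [hord] using k.val_lt) (by simpa [hord] using l.val_lt) hkl

theorem ActsAsDihedral.eq (h2 : (2 : L) ≠ 0) (hi : i ^ 2 = -1) (hx : x ≠ 0) {φ : Gal(L/F)}
    {d e : DihedralGroup 4} (hd : ActsAsDihedral x i φ d) (he : ActsAsDihedral x i φ e) :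
    d = e := by
  have hne := ne_neg_of_sq_eq_neg_one h2 hi
  rcases d with k | k <;> rcases e with l | l
  · exact congrArg r (pow_val_injective h2 hi (mul_right_cancel₀ hx (hd.2.symm.trans he.2)))
  · exact (hne (hd.1.symm.trans he.1)).elim
  · exact (hne (he.1.symm.trans hd.1)).elim
  · exact congrArg sr (neg_injective
      (pow_val_injective h2 hi (mul_right_cancel₀ hx (hd.2.symm.trans he.2))))

theorem ActsAsDihedral.mul (hi : i ^ 2 = -1) {φ ψ : Gal(L/F)} {d e : DihedralGroup 4}
    (hd : ActsAsDihedral x i φ d) (he : ActsAsDihedral x i ψ e) :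
    ActsAsDihedral x i (φ * ψ) (d * e) := by
  rcases d with k | k <;> rcases e with l | l <;> obtain ⟨hd1, hd2⟩ := hd <;>
    obtain ⟨he1, he2⟩ := he
  · refine ⟨by rw [AlgEquiv.mul_apply, he1, hd1], ?_⟩
    rw [AlgEquiv.mul_apply, he2, map_mul, map_pow, hd1, hd2, add_comm, pow_val_add hi]
    ring
  · refine ⟨by rw [AlgEquiv.mul_apply, he1, map_neg, hd1], ?_⟩
    rw [AlgEquiv.mul_apply, he2, map_mul, map_pow, hd1, hd2,
      show -(l - k) = -l + k by ring, pow_val_add hi]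
    ring
  · refine ⟨by rw [AlgEquiv.mul_apply, he1, hd1], ?_⟩
    rw [AlgEquiv.mul_apply, he2, map_mul, map_pow, hd1, hd2, neg_pow_val hi,
      show -(k + l) = -l + -k by ring, pow_val_add hi]
    ring
  · refine ⟨by rw [AlgEquiv.mul_apply, he1, map_neg, hd1, neg_neg], ?_⟩
    rw [AlgEquiv.mul_apply, he2, map_mul, map_pow, hd1, hd2, neg_pow_val hi, neg_neg,
      show l - k = l + -k by ring, pow_val_add hi]
    ring

theorem exists_eq_pow_val_mul (hi : i ^ 2 = -1) {y : L} (h : y ^ 4 = x ^ 4) :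
    ∃ k : ZMod 4, y = i ^ k.val * x := by
  have hprod : (y - x) * (y + x) * ((y - i * x) * (y + i * x)) = 0 := by
    linear_combination h + (-x ^ 2 * y ^ 2 + x ^ 4) * hi
  rcases mul_eq_zero.1 hprod with h | h <;> rcases mul_eq_zero.1 h with h | h
  · exact ⟨0, by rw [show (0 : ZMod 4).val = 0 from rfl]; linear_combination h⟩
  · exact ⟨2, by rw [show (2 : ZMod 4).val = 2 from rfl]; linear_combination h - x * hi⟩
  · exact ⟨1, by rw [show (1 : ZMod 4).val = 1 from rfl]; linear_combination h⟩
  · exact ⟨3, by rw [show (3 : ZMod 4).val = 3 from rfl]; linear_combination h - i * x * hi⟩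

theorem exists_actsAsDihedral (hi : i ^ 2 = -1) {a : F} (hx : x ^ 4 = algebraMap F L a)
    (φ : Gal(L/F)) : ∃ d, ActsAsDihedral x i φ d := by
  obtain ⟨k, hk⟩ := exists_eq_pow_val_mul hi (x := x) (y := φ x)
    (by rw [← map_pow, hx, AlgEquiv.commutes])
  have : (φ i) ^ 2 = i ^ 2 := by rw [← map_pow, hi, map_neg, map_one]
  rcases sq_eq_sq_iff_eq_or_eq_neg.1 this with h | h
  · exact ⟨r k, h, hk⟩
  · exact ⟨sr (-k), h, by rwa [neg_neg]⟩

/-- Injective because `x` and `i` generate `L`. Surjective because `ρ` moves `x²`, hence is a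
rotation of order four, and `τ` is a reflection. -/
theorem exists_mulEquiv_dihedralGroup (h2 : (2 : L) ≠ 0) (hi : i ^ 2 = -1) (hx0 : x ≠ 0) {a : F}
    (hx : x ^ 4 = algebraMap F L a) (htop : IntermediateField.adjoin F {x, i} = ⊤)
    {ρ τ : Gal(L/F)} (hρi : ρ i = i) (hρx : ρ (x ^ 2) = -x ^ 2) (hτ : τ i = -i) :
    ∃ e : Gal(L/F) ≃* DihedralGroup 4, ∀ φ, ActsAsDihedral x i φ (e φ) := by
  choose f hf using exists_actsAsDihedral (F := F) (x := x) hi hx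
  let f' : Gal(L/F) →* DihedralGroup 4 :=
    MonoidHom.mk' f fun φ ψ => (hf (φ * ψ)).eq h2 hi hx0 ((hf φ).mul hi (hf ψ))
  have hinj : Function.Injective f' := by
    intro φ ψ h
    have h1 : ActsAsDihedral x i φ (f φ) := hf φ
    have h3 : ActsAsDihedral x i ψ (f φ) := by
      rw [show f φ = f ψ from h]
      exact hf ψ
    have hagree : φ i = ψ i ∧ φ x = ψ x := by
      rcases hd : f φ with k | k <;> rw [hd] at h1 h3 <;>
        exact ⟨h1.1.trans h3.1.symm, h1.2.trans h3.2.symm⟩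
    ext y
    have hy : y ∈ IntermediateField.adjoin F {x, i} := htop ▸ IntermediateField.mem_top
    induction hy using IntermediateField.adjoin_induction with
    | mem y hy =>
      rcases hy with rfl | rfl
      exacts [hagree.2, hagree.1]
    | algebraMap c => rw [φ.commutes, ψ.commutes]
    | add y z _ _ hy hz => rw [map_add, map_add, hy, hz]
    | inv y _ hy => rw [map_inv₀, map_inv₀, hy]
    | mul y z _ _ hy hz => rw [map_mul, map_mul, hy, hz]
  have hsurj : Function.Surjective f' := by
    obtain ⟨k, hk⟩ : ∃ k, f' ρ = r k := by
      have h := hf ρ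
      rcases hd : f ρ with k | k
      · exact ⟨k, hd⟩
      · rw [hd] at h
        exact (ne_neg_of_sq_eq_neg_one h2 hi (hρi.symm.trans h.1)).elim
    obtain ⟨j, hj⟩ : ∃ j, f' τ = sr j := by
      have h := hf τ
      rcases hd : f τ with j | j
      · rw [hd] at h
        exact (ne_neg_of_sq_eq_neg_one h2 hi (h.1.symm.trans hτ)).elim
      · exact ⟨j, hd⟩
    have hkx : ρ x = i ^ k.val * x := by
      have h := hf ρ
      rw [show f ρ = r k from hk] at h
      exact h.2
    rw [map_pow, hkx] at hρx
    have hx2 : (2 : L) * x ^ 2 ≠ 0 := mul_ne_zero h2 (pow_ne_zero 2 hx0)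
    have hk0 : k ≠ 0 := by
      rintro rfl
      rw [ZMod.val_zero] at hρx
      exact hx2 (by linear_combination hρx)
    have hk2 : k ≠ 2 := by
      rintro rfl
      rw [show (2 : ZMod 4).val = 2 from rfl] at hρx
      exact hx2 (by linear_combination hρx - (i ^ 2 - 1) * x ^ 2 * hi)
    intro d
    obtain ⟨n, m, rfl⟩ := DihedralGroup.four_eq_pow_mul_pow k j hk0 hk2 d
    exact ⟨ρ ^ (n : ℕ) * τ ^ (m : ℕ), by rw [map_mul, map_pow, map_pow, hk, hj]⟩
  exact ⟨MulEquiv.ofBijective f' ⟨hinj, hsurj⟩, hf⟩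

theorem not_mem_center_of_actsAsDihedral {e : Gal(L/F) ≃* DihedralGroup 4}
    (he : ∀ φ, ActsAsDihedral x i φ (e φ)) {φ : Gal(L/F)} (hφ : φ i ≠ i) :
    φ ∉ Subgroup.center Gal(L/F) := by
  intro hc
  have h := he φ
  rcases hd : e φ with j | j <;> rw [hd] at h
  · exact hφ h.1
  · have hcomm := congrArg e (Subgroup.mem_center_iff.1 hc (e.symm (r 1)))
    rw [map_mul, map_mul, hd, e.apply_symm_apply] at hcomm
    have hne : ∀ j : ZMod 4, (r 1 : DihedralGroup 4) * sr j ≠ sr j * r 1 := by decide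
    exact hne j hcomm

end

end Dihedral

/-! ### The dihedral extension of a formally real field -/

section FormallyReal

variable {F : Type*} [Field F]

theorem normal_adjoin_fourth_root {r i : quadraticClosure F} {a : F} (hi : i ^ 2 = -1)
    (hr : r ^ 4 = algebraMap F _ a) : Normal F (IntermediateField.adjoin F {r, i}) := by
  rw [IntermediateField.normal_iff_forall_map_le']
  intro σ
  have hrL : r ∈ IntermediateField.adjoin F {r, i} :=
    IntermediateField.subset_adjoin F _ (by simp)
  have hiL : i ∈ IntermediateField.adjoin F {r, i} :=
    IntermediateField.subset_adjoin F _ (by simp)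
  rw [IntermediateField.adjoin_map, IntermediateField.adjoin_le_iff]
  rintro _ ⟨y, rfl | rfl, rfl⟩
  · obtain ⟨k, hk⟩ := exists_eq_pow_val_mul hi (x := y) (y := σ y)
      (by rw [← map_pow, hr, AlgEquiv.commutes])
    change σ y ∈ _
    rw [hk]
    exact mul_mem (pow_mem hiL _) hrL
  · change σ y ∈ _
    rcases apply_eq_or_eq_neg σ hi (by rw [map_neg, map_one]) with h | h
    · rwa [h]
    · rw [h]; exact neg_mem hiL

/-- If `a` and `-a` are not squares then some automorphism fixes `√-1` and moves `√a`. -/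
theorem exists_apply_eq_and_apply_eq_neg (h2 : (2 : F) ≠ 0) {a : F} (ha : ¬ IsSquare a)
    (hna : ¬ IsSquare (-a)) {i α : quadraticClosure F} (hi : i ^ 2 = -1)
    (hα : α ^ 2 = algebraMap F _ a) :
    ∃ g : QuadraticGaloisGroup F, g i = i ∧ g α = -α := by
  have hgi : ∀ g : QuadraticGaloisGroup F, g i = i ∨ g i = -i := fun g =>
    apply_eq_or_eq_neg g hi (by rw [map_neg, map_one])
  have hgα : ∀ g : QuadraticGaloisGroup F, g α = α ∨ g α = -α := fun g =>
    apply_eq_or_eq_neg g hα (AlgEquiv.commutes _ _)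
  have hi0 := ne_zero_of_sq_eq_neg_one hi
  obtain ⟨g, hg⟩ := exists_apply_ne h2 ha hα
  obtain ⟨h, hh⟩ := exists_apply_ne h2 hna (α := i * α)
    (by rw [mul_pow, hi, hα, map_neg, neg_one_mul])
  rw [map_mul] at hh
  rcases hgi g with h1 | h1
  · exact ⟨g, h1, hg⟩
  rcases hgi h with h3 | h3
  · rw [h3] at hh
    exact ⟨h, h3, mul_left_cancel₀ hi0 (by linear_combination hh)⟩
  · rw [h3] at hh
    have h4 : h α = α := mul_left_cancel₀ hi0 (by linear_combination -hh)
    -- Here `g` and `h` both negate `i`, while `h` fixes `α` and `g` negates it.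
    exact ⟨g * h, by rw [AlgEquiv.mul_apply, h3, map_neg, h1, neg_neg],
      by rw [AlgEquiv.mul_apply, h4, hg]⟩

theorem exists_dihedral_of_not_isSumSq (h2 : (2 : F) ≠ 0) (h : ¬ IsSumSq (-1 : F))
    (hcard : 2 < ENat.card (WGroup F)) :
    ∃ (a : F) (r i : quadraticClosure F),
      r ^ 4 = algebraMap F (quadraticClosure F) a ∧ i ^ 2 = -1 ∧
      IsGalois F (IntermediateField.adjoin F {r, i}) ∧
      Nonempty (Gal((IntermediateField.adjoin F {r, i})/F) ≃* DihedralGroup 4) ∧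
      ∃ π : WGroup F →* Gal((IntermediateField.adjoin F {r, i})/F),
        Function.Surjective π ∧
        (∀ (g : QuadraticGaloisGroup F) (x : IntermediateField.adjoin F {r, i}),
          ((π (QuotientGroup.mk g) x : IntermediateField.adjoin F {r, i}) :
            quadraticClosure F) = g x) ∧
        ∃ σ : WGroup F, orderOf σ = 2 ∧ π σ ∉ Subgroup.center _ ∧
          σ ∉ Subgroup.center (WGroup F) := by
  have hgal := quadraticClosure_isGalois h2
  obtain ⟨a, ha, hna⟩ := exists_not_isSquare_of_two_lt_card h2 h hcard
  obtain ⟨i, hi⟩ := exists_sq_eq (-1 : quadraticClosure F)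
  obtain ⟨α, hα⟩ := exists_sq_eq (algebraMap F (quadraticClosure F) a)
  obtain ⟨r, hr⟩ := exists_sq_eq α
  have hr4 : r ^ 4 = algebraMap F (quadraticClosure F) a := by
    rw [← hα, ← hr]; ring
  have hnormal := normal_adjoin_fourth_root hi hr4
  have hr0 : r ≠ 0 := by
    rintro rfl
    have : a = 0 := by simpa using hr4.symm
    exact ha ⟨0, by simp [this]⟩
  obtain ⟨ρ, hρi, hρα⟩ := exists_apply_eq_and_apply_eq_neg h2 ha hna hi hα
  obtain ⟨τ, hτ, hτi⟩ := exists_involution h2 h hi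
  set L := IntermediateField.adjoin F {r, i} with hL
  have hrL : r ∈ L := IntermediateField.subset_adjoin F _ (by simp)
  have hiL : i ∈ L := IntermediateField.subset_adjoin F _ (by simp)
  have h2L : (2 : L) ≠ 0 := two_ne_zero_of_algebra h2
  have hres : ∀ (g : QuadraticGaloisGroup F) (x : L),
      ((AlgEquiv.restrictNormalHom L g x : L) : quadraticClosure F) = g x :=
    fun g x => AlgEquiv.restrictNormal_commutes g L x
  have htop : IntermediateField.adjoin F {(⟨r, hrL⟩ : L), ⟨i, hiL⟩} = ⊤ := by
    apply IntermediateField.lift_injective L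
    rw [IntermediateField.lift_adjoin, IntermediateField.lift_top, Set.image_pair]
  obtain ⟨e, he⟩ := exists_mulEquiv_dihedralGroup (F := F) (x := (⟨r, hrL⟩ : L)) (i := ⟨i, hiL⟩)
    h2L (Subtype.ext hi) (fun h => hr0 (congrArg Subtype.val h)) (Subtype.ext hr4) htop
    (ρ := AlgEquiv.restrictNormalHom L ρ) (τ := AlgEquiv.restrictNormalHom L τ)
    (Subtype.ext ((hres _ _).trans hρi))
    (Subtype.ext ((hres _ _).trans (by
      change ρ (r ^ 2) = -r ^ 2
      rw [hr, hρα])))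
    (Subtype.ext ((hres _ _).trans hτi))
  -- Restriction kills the relators, as `D_4` has exponent four and central squares; closedness of
  -- stabilizers extends this to the kernel.
  have hker : ∀ w ∈ wKernel F, AlgEquiv.restrictNormalHom L w = 1 := by
    intro w hw
    refine AlgEquiv.ext fun x => Subtype.ext ?_
    rw [hres, AlgEquiv.one_apply]
    refine apply_eq_of_mem_wKernel (fun w hw => ?_) hw
    have hw1 : AlgEquiv.restrictNormalHom L w = 1 := by
      apply e.injective
      rw [map_one]
      apply DihedralGroup.four_wRelators_eq_one
      rcases hw with ⟨g, rfl⟩ | ⟨g, k, rfl⟩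
      · exact Or.inl ⟨e (AlgEquiv.restrictNormalHom L g), by simp only [map_pow]⟩
      · exact Or.inr ⟨e (AlgEquiv.restrictNormalHom L g), e (AlgEquiv.restrictNormalHom L k), by
          simp only [map_mul, map_pow, map_inv]⟩
    rw [← hres, hw1, AlgEquiv.one_apply]
  let π : WGroup F →* Gal(L/F) := QuotientGroup.lift (wKernel F) (AlgEquiv.restrictNormalHom L) hker
  have hπ : Function.Surjective π := fun φ => by
    obtain ⟨g, hg⟩ := AlgEquiv.restrictNormalHom_surjective (F := F) (K₁ := L)
      (quadraticClosure F) φ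
    exact ⟨QuotientGroup.mk g, hg⟩
  have hτL : AlgEquiv.restrictNormalHom L τ ⟨i, hiL⟩ ≠ ⟨i, hiL⟩ := by
    intro h'
    have h' := (hres τ ⟨i, hiL⟩).symm.trans (congrArg Subtype.val h')
    have h'' : -i = i := hτi.symm.trans h'
    exact ne_neg_of_sq_eq_neg_one h2L (i := ⟨i, hiL⟩) (Subtype.ext hi) (Subtype.ext h''.symm)
  have hnc : π (QuotientGroup.mk τ) ∉ Subgroup.center Gal(L/F) :=
    not_mem_center_of_actsAsDihedral he hτL
  refine ⟨a, r, i, hr4, hi, {}, ⟨e⟩, π, hπ, hres, QuotientGroup.mk τ, ?_, hnc, fun hc => hnc ?_⟩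
  · refine orderOf_eq_prime ?_ fun h1 => hnc ?_
    · rw [← QuotientGroup.mk_pow, hτ, QuotientGroup.mk_one]
    · rw [h1, map_one]
      exact one_mem _
  · rw [Subgroup.mem_center_iff] at hc ⊢
    intro φ
    obtain ⟨s, rfl⟩ := hπ φ
    rw [← map_mul, ← map_mul, hc]

end FormallyReal

theorem theorem2p1 (F : Type*) [Field F] (hchar : ringChar F ≠ 2)
    (hcard : 2 < ENat.card (WGroup F)) :
    (IsSumSq (-1 : F) ↔ ∀ σ : WGroup F, orderOf σ = 2 → σ ∈ Subgroup.center (WGroup F)) ∧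
    (¬ IsSumSq (-1 : F) →
      ∃ (a : F) (r i : quadraticClosure F),
        r ^ 4 = algebraMap F (quadraticClosure F) a ∧ i ^ 2 = -1 ∧
        IsGalois F (IntermediateField.adjoin F {r, i}) ∧
        Nonempty (Gal((IntermediateField.adjoin F {r, i})/F) ≃* DihedralGroup 4) ∧
        ∃ π : WGroup F →* Gal((IntermediateField.adjoin F {r, i})/F),
          Function.Surjective π ∧
          (∀ (g : QuadraticGaloisGroup F) (x : IntermediateField.adjoin F {r, i}),
            ((π (QuotientGroup.mk g) x : IntermediateField.adjoin F {r, i}) :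
              quadraticClosure F) = g x) ∧
          ∃ σ : WGroup F, orderOf σ = 2 ∧ π σ ∉ Subgroup.center _ ∧
            σ ∉ Subgroup.center (WGroup F)) := by
  have h2 : (2 : F) ≠ 0 := Ring.two_ne_zero hchar
  refine ⟨⟨fun hF σ hσ => mem_center_of_sq_eq_one h2 hF (hσ ▸ pow_orderOf_eq_one σ), fun hc => ?_⟩,
    fun h => exists_dihedral_of_not_isSumSq h2 h hcard⟩
  by_contra h
  obtain ⟨a, r, i, -, -, -, -, π, -, -, σ, hσ, -, hnc⟩ := exists_dihedral_of_not_isSumSq h2 h hcard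
  exact hnc (hc σ hσ)
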